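/- All graphs are finite, undirected, and have no loops or multiple edges. A graph is self-complementary if it is isomorphic to its complement, and it is non-empty if it has at least one vertex. For a set ${\cal H}$ of graphs, a graph is ${\cal H}$-free if it has no induced subgraph isomorphic to a graph in ${\cal H}$. $P_r$ denotes the path on $r$ vertices, and membership of a graph in ${\cal H}$ is understood up to isomorphism. The clique-width of a graph $G$ is the minimum number of labels needed to construct $G$ (up to isomorphism, ignoring the final labels) by the following four operations: (i) creating a new graph consisting of a single vertex with label $i$; (ii) taking the disjoint union of two labelled graphs; (iii) joining each vertex with label $i$ to each vertex with label $j$, where $i\neq j$; (iv) renaming label $i$ to $j$. The graph without vertices has clique-width $0$ by convention. A class of graphs has bounded clique-width if there is a constant $c$ such that every graph in the class has clique-width at most $c$. Theorem. Let ${\cal H}$ be a (possibly infinite) set of non-empty self-complementary graphs. Then the class of ${\cal H}$-free graphs has bounded clique-width if and only if $P_1\in{\cal H}$ or $P_4\in{\cal H}$. -/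

import Mathlib

universe u

/-- A finite simple graph: undirected, without loops or multiple edges. -/
structure FinGraph where
  V : Type u
  [finite : Finite V]
  graph : SimpleGraph V

namespace FinGraph

/-- The graph has at least one vertex. -/
def IsNonempty (G : FinGraph.{u}) : Prop := Nonempty G.V

/-- A graph is self-complementary if it is isomorphic to its complement. -/
def IsSelfComplementary (G : FinGraph.{u}) : Prop := Nonempty (G.graph ≃g G.graphᶜ)

/-- The path on `n` vertices belongs to the set `ℋ`; as usual for sets of graphs, membership is
understood up to isomorphism. -/
def PathMem (n : ℕ) (ℋ : Set FinGraph.{u}) : Prop :=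
  ∃ H ∈ ℋ, Nonempty (H.graph ≃g SimpleGraph.pathGraph n)

/-- The class of `ℋ`-free graphs: no induced subgraph is isomorphic to a member of `ℋ`. -/
def freeClass (ℋ : Set FinGraph.{u}) : Set FinGraph.{u} :=
  {G | ∀ H ∈ ℋ, ¬ H.graph.IsIndContained G.graph}

end FinGraph

/-- Expressions built from the four clique-width operations with labels from `Fin k`. -/
inductive CWExpr (k : ℕ) : Type
  /-- a new graph with a single vertex, labelled `i` -/
  | vertex (i : Fin k) : CWExpr k
  /-- disjoint union of two labelled graphs -/
  | union (e₁ e₂ : CWExpr k) : CWExpr k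
  /-- join every vertex labelled `i` to every vertex labelled `j`, where `i ≠ j` -/
  | join (i j : Fin k) (h : i ≠ j) (e : CWExpr k) : CWExpr k
  /-- rename label `i` to `j` -/
  | relabel (i j : Fin k) (e : CWExpr k) : CWExpr k

namespace CWExpr

/-- The vertex set of the constructed graph. -/
def Vert {k : ℕ} : CWExpr k → Type
  | vertex _ => Unit
  | union e₁ e₂ => e₁.Vert ⊕ e₂.Vert
  | join _ _ _ e => e.Vert
  | relabel _ _ e => e.Vert

/-- The labels of the vertices of the constructed graph. -/
def label {k : ℕ} : (e : CWExpr k) → e.Vert → Fin k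
  | vertex i => fun _ => i
  | union e₁ e₂ => Sum.elim e₁.label e₂.label
  | join _ _ _ e => e.label
  | relabel i j e => fun v => if e.label v = i then j else e.label v

/-- The constructed graph. -/
def graph {k : ℕ} : (e : CWExpr k) → SimpleGraph e.Vert
  | vertex _ => (⊥ : SimpleGraph Unit)
  | union e₁ e₂ => SimpleGraph.sum e₁.graph e₂.graph
  | join i j _ e => e.graph ⊔ SimpleGraph.fromRel (fun u v => e.label u = i ∧ e.label v = j)
  | relabel _ _ e => e.graph

end CWExpr

/-- `G` can be constructed with `k` labels. The graph without vertices, which none of the operations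
produces, needs no construction. -/
def ConstructibleWith (k : ℕ) {V : Type u} (G : SimpleGraph V) : Prop :=
  IsEmpty V ∨ ∃ e : CWExpr k, Nonempty (e.graph ≃g G)

/-- The clique-width: the least number of labels with which `G` can be constructed (and `⊤` if there
is no such number, which does not happen for finite graphs). -/
noncomputable def cliqueWidth {V : Type u} (G : SimpleGraph V) : ℕ∞ :=
  ⨅ (k : ℕ) (_ : ConstructibleWith k G), (k : ℕ∞)

/-- A class of graphs has bounded clique-width if one constant bounds the clique-width of all its
members. -/
def HasBoundedCliqueWidth (𝒢 : Set FinGraph.{u}) : Prop :=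
  ∃ c : ℕ, ∀ G ∈ 𝒢, cliqueWidth G.graph ≤ (c : ℕ∞)

/-! ### Cographs: `P₄`-free graphs are constructible with two labels -/

/-! If `P₁ ∈ ℋ`, only the empty graph is free. If `P₄ ∈ ℋ`, free graphs are cographs:
`splitsOn_or_compl` breaks them up recursively by disjoint unions and joins, so two labels suffice.

Conversely, bipartite graphs of unbounded clique-width are all free unless `P₁` or `P₄` lies in `ℋ`.
A bipartite self-complementary graph has a 2-colourable complement, hence at most four vertices, and
`iso_pathGraph_of_iso_compl_of_coloring` leaves only `P₁` and `P₄`. For `pairIncidence`, an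
expression with few labels yields, by `CWExpr.hasBalancedSet`, a medium-sized vertex set whose
members have few neighbourhood types towards the outside; incidences with pairs force too many
types. -/

theorem CWExpr.join_adj {k : ℕ} {i j : Fin k} {h : i ≠ j} {e : CWExpr k} {u v : e.Vert} :
    (CWExpr.join i j h e).graph.Adj u v ↔ e.graph.Adj u v ∨
      u ≠ v ∧ (e.label u = i ∧ e.label v = j ∨ e.label v = i ∧ e.label u = j) := Iff.rfl

section Cograph

variable {V : Type u} {G : SimpleGraph V}

/-- `s` splits into two nonempty parts with no edges between them. -/
def SimpleGraph.SplitsOn (G : SimpleGraph V) (s : Set V) : Prop :=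
  ∃ S T : Set V, S.Nonempty ∧ T.Nonempty ∧ Disjoint S T ∧ S ∪ T = s ∧
    ∀ a ∈ S, ∀ b ∈ T, ¬ G.Adj a b

/-- `G` has no induced path `a - b - c - d`. -/
def SimpleGraph.InducedPathFree (G : SimpleGraph V) : Prop :=
  ∀ a b c d : V, a ≠ c → b ≠ d → a ≠ d → G.Adj a b → G.Adj b c → G.Adj c d →
    ¬ G.Adj a c → ¬ G.Adj b d → ¬ G.Adj a d → False

/-- `P₄` is self-complementary: an induced path `a b c d` of the complement is the induced path `b d
a c` of `G`. -/
theorem SimpleGraph.InducedPathFree.compl (h : G.InducedPathFree) : Gᶜ.InducedPathFree := by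
  intro a b c d hac hbd had hab hbc hcd nac nbd nad
  simp only [SimpleGraph.compl_adj, not_and, not_not] at *
  exact h b d a c hab.1.symm hcd.1.symm hbc.1 (nbd hbd) (nad had).symm (nac hac)
    (fun h => hab.2 h.symm) (fun h => hcd.2 h.symm) hbc.2

/-- Of a set split into `S` and `T`, the vertex `v` sees part of `S` and some of `T`: then the
vertices of `S` that `v` misses split off. -/
theorem SimpleGraph.InducedPathFree.splitsOn_insert_aux (h : G.InducedPathFree) {S T : Set V}
    {v : V} (hST : Disjoint S T) (hvS : v ∉ S) (hvT : v ∉ T)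
    (hanti : ∀ a ∈ S, ∀ b ∈ T, ¬ G.Adj a b) (hTv : ∃ z ∈ T, G.Adj v z)
    (hS : ∃ y ∈ S, ¬ G.Adj v y) : G.SplitsOn (insert v (S ∪ T)) := by
  obtain ⟨z, hz, hvz⟩ := hTv
  obtain ⟨y₀, hy₀, hvy₀⟩ := hS
  refine ⟨{y ∈ S | ¬ G.Adj v y}, insert v ({x ∈ S | G.Adj v x} ∪ T), ⟨y₀, hy₀, hvy₀⟩,
    ⟨v, by simp⟩, ?_, ?_, ?_⟩
  · rw [Set.disjoint_left] at hST ⊢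
    rintro a ⟨ha, hva⟩ (rfl | ⟨_, hb⟩ | hb)
    · exact hvS ha
    · exact hva hb
    · exact hST ha hb
  · ext x
    simp only [Set.mem_union, Set.mem_insert_iff, Set.mem_ofPred_eq]
    tauto
  · rintro y ⟨hy, hvy⟩ b (rfl | ⟨hb, hvb⟩ | hb)
    · exact fun h => hvy h.symm
    · intro hyb
      -- An edge from a missed `y` to a seen `b` would give the induced path `y b v z`.
      refine h y b v z ?_ ?_ ?_ hyb hvb.symm hvz (fun h => hvy h.symm) (hanti b hb z hz)
        (hanti y hy z hz)
      · rintro rfl; exact hvS hy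
      · rintro rfl; exact Set.disjoint_left.1 hST hb hz
      · rintro rfl; exact Set.disjoint_left.1 hST hy hz
    · exact hanti y hy b hb

/-- If `v` has no neighbour in one part, it joins the other part; if it sees everything, it is
isolated in the complement; the mixed case is `splitsOn_insert_aux`. -/
theorem SimpleGraph.InducedPathFree.splitsOn_insert (h : G.InducedPathFree) {s : Set V} {v : V}
    (hv : v ∉ s) (hs : G.SplitsOn s) :
    G.SplitsOn (insert v s) ∨ Gᶜ.SplitsOn (insert v s) := by
  obtain ⟨S, T, hS, hT, hST, rfl, hanti⟩ := hs
  have hvS : v ∉ S := fun h => hv (Or.inl h)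
  have hvT : v ∉ T := fun h => hv (Or.inr h)
  by_cases hTv : ∃ z ∈ T, G.Adj v z
  · by_cases hSv : ∃ z ∈ S, G.Adj v z
    · by_cases hS' : ∃ y ∈ S, ¬ G.Adj v y
      · exact Or.inl (h.splitsOn_insert_aux hST hvS hvT hanti hTv hS')
      by_cases hT' : ∃ y ∈ T, ¬ G.Adj v y
      · left
        rw [Set.union_comm]
        exact h.splitsOn_insert_aux hST.symm hvT hvS (fun a ha b hb hab => hanti b hb a ha hab.symm)
          hSv hT'
      push Not at hS' hT'
      right
      refine ⟨{v}, S ∪ T, by simp, hS.mono Set.subset_union_left, by simpa using hv, rfl, ?_⟩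
      rintro _ rfl b (hb | hb)
      · simp [hS' b hb]
      · simp [hT' b hb]
    · push Not at hSv
      refine Or.inl ⟨S, insert v T, hS, ⟨v, by simp⟩, ?_, by rw [Set.union_insert], ?_⟩
      · rw [Set.disjoint_insert_right]; exact ⟨hvS, hST⟩
      · rintro a ha b (rfl | hb)
        · exact fun h => hSv a ha h.symm
        · exact hanti a ha b hb
  · push Not at hTv
    refine Or.inl ⟨insert v S, T, ⟨v, by simp⟩, hT, ?_, by rw [Set.insert_union], ?_⟩
    · rw [Set.disjoint_insert_left]; exact ⟨hvT, hST⟩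
    · rintro a (rfl | ha) b hb
      · exact hTv b hb
      · exact hanti a ha b hb

/-- Every set of at least two vertices of a `P₄`-free graph splits in the graph or in its
complement. -/
theorem SimpleGraph.InducedPathFree.splitsOn_or_compl (h : G.InducedPathFree) {s : Set V}
    (hfin : s.Finite) (hs : s.Nontrivial) : G.SplitsOn s ∨ Gᶜ.SplitsOn s := by
  induction s, hfin using Set.Finite.induction_on with
  | empty => simp at hs
  | @insert v s hv _ ih =>
    rcases s.eq_empty_or_nonempty with rfl | ⟨w, hw⟩
    · simp at hs
    by_cases hs' : s.Nontrivial
    · rcases ih hs' with ih | ih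
      · exact h.splitsOn_insert hv ih
      · simpa [or_comm] using h.compl.splitsOn_insert hv ih
    · obtain rfl : s = {w} := (Set.not_nontrivial_iff.1 hs').eq_singleton_of_mem hw
      have hvw : v ≠ w := by simpa using hv
      have hpart : ({v} ∪ {w} : Set V) = insert v {w} := rfl
      by_cases hadj : G.Adj v w
      · exact Or.inr ⟨{v}, {w}, by simp, by simp, by simpa using hvw, hpart, by simp [hadj]⟩
      · exact Or.inl ⟨{v}, {w}, by simp, by simp, by simpa using hvw, hpart, by simp [hadj]⟩

/-- The subgraph induced on `s` is built by an expression with two labels in which all vertices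
finally have label `0`. -/
def BuildsOn (G : SimpleGraph V) (s : Set V) : Prop :=
  ∃ (e : CWExpr 2) (f : e.Vert → V), Function.Injective f ∧ Set.range f = s ∧
    (∀ u v, e.graph.Adj u v ↔ G.Adj (f u) (f v)) ∧ ∀ v, e.label v = 0

theorem BuildsOn.singleton (v : V) : BuildsOn G {v} := by
  refine ⟨.vertex 0, fun _ => v, ?_, ?_, ?_, fun _ => rfl⟩
  · intro a b _; cases a; cases b; rfl
  · ext x
    constructor
    · rintro ⟨_, rfl⟩; rfl
    · rintro rfl; exact ⟨(), rfl⟩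
  · exact fun a b => iff_of_false id G.irrefl

theorem BuildsOn.union {S T : Set V} (hS : BuildsOn G S) (hT : BuildsOn G T) (hST : Disjoint S T)
    (hanti : ∀ a ∈ S, ∀ b ∈ T, ¬ G.Adj a b) : BuildsOn G (S ∪ T) := by
  obtain ⟨e₁, f₁, inj₁, rfl, adj₁, lab₁⟩ := hS
  obtain ⟨e₂, f₂, inj₂, rfl, adj₂, lab₂⟩ := hT
  refine ⟨.union e₁ e₂, Sum.elim f₁ f₂, ?_, Set.Sum.elim_range f₁ f₂, ?_, ?_⟩
  · exact inj₁.sumElim inj₂ fun a b hab =>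
      Set.disjoint_left.1 hST ⟨a, rfl⟩ (hab ▸ ⟨b, rfl⟩)
  · rintro (a | a) (b | b)
    · exact adj₁ a b
    · exact iff_of_false (by simp [CWExpr.graph]) (hanti _ ⟨a, rfl⟩ _ ⟨b, rfl⟩)
    · exact iff_of_false (by simp [CWExpr.graph])
        fun h => hanti _ ⟨b, rfl⟩ _ ⟨a, rfl⟩ h.symm
    · exact adj₂ a b
  · rintro (a | a)
    · exact lab₁ a
    · exact lab₂ a

theorem BuildsOn.join {S T : Set V} (hS : BuildsOn G S) (hT : BuildsOn G T) (hST : Disjoint S T)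
    (hcomp : ∀ a ∈ S, ∀ b ∈ T, G.Adj a b) : BuildsOn G (S ∪ T) := by
  obtain ⟨e₁, f₁, inj₁, rfl, adj₁, lab₁⟩ := hS
  obtain ⟨e₂, f₂, inj₂, rfl, adj₂, lab₂⟩ := hT
  -- Label `1` only marks the second part during the join; the outer relabelling restores the
  -- all-`0` invariant.
  refine ⟨.relabel 1 0 (.join 0 1 (by decide) (.union e₁ (.relabel 0 1 e₂))), Sum.elim f₁ f₂, ?_,
    Set.Sum.elim_range f₁ f₂, ?_, ?_⟩
  · exact inj₁.sumElim inj₂ fun a b hab =>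
      Set.disjoint_left.1 hST ⟨a, rfl⟩ (hab ▸ ⟨b, rfl⟩)
  · have lab₂' : ∀ a, (CWExpr.relabel 0 1 e₂).label a = 1 := fun a => if_pos (lab₂ a)
    have lab_inl : ∀ a, (CWExpr.union e₁ (.relabel 0 1 e₂)).label (Sum.inl a) = 0 := lab₁
    have lab_inr : ∀ a, (CWExpr.union e₁ (.relabel 0 1 e₂)).label (Sum.inr a) = 1 := lab₂'
    rintro (a | a) (b | b) <;> refine CWExpr.join_adj.trans ?_
    · rw [lab_inl, lab_inl]
      simp only [zero_ne_one, and_false, or_self, or_false]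
      exact adj₁ a b
    · rw [lab_inl, lab_inr]
      exact iff_of_true (Or.inr ⟨Sum.inl_ne_inr, by simp⟩) (hcomp _ ⟨a, rfl⟩ _ ⟨b, rfl⟩)
    · rw [lab_inl, lab_inr]
      exact iff_of_true (Or.inr ⟨Sum.inr_ne_inl, by simp⟩) (hcomp _ ⟨b, rfl⟩ _ ⟨a, rfl⟩).symm
    · rw [lab_inr, lab_inr]
      simp only [one_ne_zero, false_and, and_false, or_self, or_false]
      exact adj₂ a b
  · rintro (a | a)
    · exact (if_neg fun h => zero_ne_one ((lab₁ a).symm.trans h)).trans (lab₁ a)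
    · exact if_pos (if_pos (lab₂ a))

theorem SimpleGraph.InducedPathFree.buildsOn (h : G.InducedPathFree) {s : Set V}
    (hfin : s.Finite) (hs : s.Nonempty) : BuildsOn G s := by
  induction hn : s.ncard using Nat.strong_induction_on generalizing s with
  | _ n ih =>
    subst hn
    by_cases hnt : s.Nontrivial
    · have parts : ∀ S T : Set V, S.Nonempty → T.Nonempty → Disjoint S T → S ∪ T = s →
          BuildsOn G S ∧ BuildsOn G T := by
        rintro S T hS hT hST rfl
        have hSf := hfin.subset Set.subset_union_left
        have hTf := hfin.subset Set.subset_union_right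
        have hcard := Set.ncard_union_eq hST hSf hTf
        have hS0 := (Set.ncard_pos hSf).2 hS
        have hT0 := (Set.ncard_pos hTf).2 hT
        exact ⟨ih _ (by omega) hSf hS rfl, ih _ (by omega) hTf hT rfl⟩
      rcases h.splitsOn_or_compl hfin hnt with ⟨S, T, hS, hT, hST, rfl, hanti⟩ |
        ⟨S, T, hS, hT, hST, rfl, hanti⟩
      · obtain ⟨bS, bT⟩ := parts S T hS hT hST rfl
        exact bS.union bT hST hanti
      · obtain ⟨bS, bT⟩ := parts S T hS hT hST rfl
        refine bS.join bT hST fun a ha b hb => ?_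
        by_contra hab
        refine hanti a ha b hb ⟨?_, hab⟩
        rintro rfl
        exact Set.disjoint_left.1 hST ha hb
    · obtain ⟨w, hw⟩ := hs
      obtain rfl : s = {w} := (Set.not_nontrivial_iff.1 hnt).eq_singleton_of_mem hw
      exact .singleton w

theorem SimpleGraph.InducedPathFree.constructibleWith_two [Finite V] (h : G.InducedPathFree) :
    ConstructibleWith 2 G := by
  rcases isEmpty_or_nonempty V with hV | hV
  · exact Or.inl hV
  · obtain ⟨e, f, inj, hr, adj, -⟩ := h.buildsOn Set.finite_univ Set.univ_nonempty
    exact Or.inr ⟨e, ⟨⟨Equiv.ofBijective f ⟨inj, Set.range_eq_univ.1 hr⟩, (adj _ _).symm⟩⟩⟩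

theorem SimpleGraph.inducedPathFree_of_not_isIndContained
    (h : ¬ (SimpleGraph.pathGraph 4).IsIndContained G) : G.InducedPathFree := by
  intro a b c d hac hbd had hab hbc hcd nac nbd nad
  refine h ⟨⟨⟨![a, b, c, d], ?_⟩, ?_⟩⟩
  · have := hab.ne
    have := hbc.ne
    have := hcd.ne
    intro i j hij
    fin_cases i <;> fin_cases j <;> simp_all
  · intro i j
    change G.Adj (![a, b, c, d] i) (![a, b, c, d] j) ↔ _
    have := hab.symm
    have := hbc.symm
    have := hcd.symm
    have nca := fun h : G.Adj c a => nac h.symm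
    have ndb := fun h : G.Adj d b => nbd h.symm
    have nda := fun h : G.Adj d a => nad h.symm
    fin_cases i <;> fin_cases j <;> simp_all [SimpleGraph.pathGraph_adj]

theorem cliqueWidth_le_of_constructibleWith {k : ℕ} (h : ConstructibleWith k G) :
    cliqueWidth G ≤ k := iInf₂_le k h

theorem exists_constructibleWith_of_cliqueWidth_le {c : ℕ} (h : cliqueWidth G ≤ c) :
    ∃ k ≤ c, ConstructibleWith k G := by
  -- A strict bound on the infimum yields a witness `k` below it.
  have h' : cliqueWidth G < ((c + 1 : ℕ) : ℕ∞) :=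
    h.trans_lt (by exact_mod_cast Nat.lt_succ_self c)
  simp only [cliqueWidth, iInf_lt_iff] at h'
  obtain ⟨k, hk, hlt⟩ := h'
  exact ⟨k, Nat.lt_succ_iff.1 (by exact_mod_cast hlt), hk⟩

end Cograph

/-! ### Bipartite graphs contain no self-complementary graphs besides `P₁` and `P₄` -/

section SelfComplementary

variable {V : Type u} {G : SimpleGraph V}

open Classical in
theorem SimpleGraph.four_mul_card_edges_of_iso_compl [Fintype V] (φ : G ≃g Gᶜ) :
    4 * G.edgeFinset.card + Fintype.card V = Fintype.card V * Fintype.card V := by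
  have hdeg : ∀ v, G.degree v + Gᶜ.degree v + 1 = Fintype.card V := by
    intro v
    have := G.degree_compl v
    have := G.degree_lt_card_verts v
    omega
  have hsum : ∑ v, (G.degree v + Gᶜ.degree v + 1) = Fintype.card V * Fintype.card V := by
    simp [hdeg]
  have h1 := G.sum_degrees_eq_twice_card_edges
  have h2 := Gᶜ.sum_degrees_eq_twice_card_edges
  have h3 := φ.card_edgeFinset_eq
  rw [Finset.sum_add_distrib, Finset.sum_add_distrib] at hsum
  simp at hsum
  omega

/-- A nonempty self-complementary graph with a proper 2-colouring is `P₁` or `P₄`. -/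
theorem SimpleGraph.iso_pathGraph_of_iso_compl_of_coloring [Finite V] [Nonempty V] (φ : G ≃g Gᶜ)
    (C : G.Coloring Bool) :
    Nonempty (G ≃g SimpleGraph.pathGraph 1) ∨ Nonempty (G ≃g SimpleGraph.pathGraph 4) := by
  classical
  have := Fintype.ofFinite V
  let D : Gᶜ.Coloring Bool := C.comp φ.symm.toHom
  -- Distinct vertices are adjacent in `G` or in `Gᶜ`, so one of the colourings separates them.
  have inj : Function.Injective fun v => (C v, D v) := by
    intro u v huv
    simp only [Prod.mk.injEq] at huv
    by_contra hne
    by_cases hadj : G.Adj u v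
    · exact C.valid hadj huv.1
    · exact D.valid (show Gᶜ.Adj u v from ⟨hne, hadj⟩) huv.2
  have hcard := Fintype.card_le_of_injective _ inj
  have hpos : 0 < Fintype.card V := Fintype.card_pos
  have hE := G.four_mul_card_edges_of_iso_compl φ
  simp only [Fintype.card_prod, Fintype.card_bool] at hcard
  -- Two or three vertices are excluded because `n(n-1)` must be divisible by 4.
  obtain h1 | h4 : Fintype.card V = 1 ∨ Fintype.card V = 4 := by
    generalize Fintype.card V = n at *
    interval_cases n <;> omega
  · left
    obtain ⟨x, hx⟩ := Fintype.card_eq_one_iff.1 h1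
    have : Subsingleton V := ⟨fun a b => (hx a).trans (hx b).symm⟩
    refine ⟨⟨(Fintype.equivFinOfCardEq h1), ?_⟩⟩
    intro a b
    rw [Subsingleton.elim a b]
    simp
  · right
    have bij : Function.Bijective fun v => (C v, D v) :=
      (Fintype.bijective_iff_injective_and_card _).2 ⟨inj, by simp [h4]⟩
    let q := Equiv.ofBijective _ bij
    have hE3 : G.edgeFinset.card = 3 := by rw [h4] at hE; omega
    have hdeg := G.sum_degrees_eq_twice_card_edges
    have hC : ∀ p, C (q.symm p) = p.1 := fun p => congrArg Prod.fst (q.apply_symm_apply p)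
    have hD : ∀ p, D (q.symm p) = p.2 := fun p => congrArg Prod.snd (q.apply_symm_apply p)
    have hn : ∀ i j j', ¬ G.Adj (q.symm (i, j)) (q.symm (i, j')) := by
      intro i j j' h
      exact C.valid h (by rw [hC, hC])
    have hy : ∀ i i' j, i ≠ i' → G.Adj (q.symm (i, j)) (q.symm (i', j)) := by
      intro i i' j hne
      by_contra h
      refine D.valid (show Gᶜ.Adj (q.symm (i, j)) (q.symm (i', j)) from ⟨?_, h⟩) (by rw [hD, hD])
      simpa using hne
    -- Two edges are forced by `hy` and only the two diagonals are open; three edges in all mean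
    -- exactly one diagonal, which completes a path.
    have hcount : ∑ v, G.degree v =
        ∑ p : Bool × Bool, ∑ r : Bool × Bool, if G.Adj (q.symm p) (q.symm r) then 1 else 0 := by
      rw [← q.symm.sum_comp]
      refine Finset.sum_congr rfl fun p _ => ?_
      rw [← G.card_neighborFinset_eq_degree, G.neighborFinset_eq_filter, Finset.card_filter,
        ← q.symm.sum_comp]
    rw [hdeg, hE3] at hcount
    simp only [Fintype.sum_prod_type, Fintype.sum_bool] at hcount
    have s1 := G.adj_comm (q.symm (true, true)) (q.symm (false, false))
    have s2 := G.adj_comm (q.symm (true, false)) (q.symm (false, true))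
    have path : ∀ a b c d : Bool × Bool, [a, b, c, d].Nodup → G.Adj (q.symm a) (q.symm b) →
        G.Adj (q.symm b) (q.symm c) → G.Adj (q.symm c) (q.symm d) →
        ¬ G.Adj (q.symm a) (q.symm c) → ¬ G.Adj (q.symm b) (q.symm d) →
        ¬ G.Adj (q.symm a) (q.symm d) → Nonempty (G ≃g SimpleGraph.pathGraph 4) := by
      intro a b c d hnd hab hbc hcd nac nbd nad
      have hind : (SimpleGraph.pathGraph 4).IsIndContained G := by
        by_contra hni
        simp only [List.nodup_cons, List.mem_cons, not_or] at hnd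
        exact SimpleGraph.inducedPathFree_of_not_isIndContained hni _ _ _ _
          (q.symm.injective.ne hnd.1.2.1) (q.symm.injective.ne hnd.2.1.2.1)
          (q.symm.injective.ne hnd.1.2.2.1) hab hbc hcd nac nbd nad
      obtain ⟨f⟩ := hind
      have fb : Function.Bijective f :=
        (Fintype.bijective_iff_injective_and_card f).2 ⟨f.injective, by simp [h4]⟩
      exact ⟨(⟨Equiv.ofBijective f fb, f.map_rel_iff⟩ : SimpleGraph.pathGraph 4 ≃g G).symm⟩
    by_cases d1 : G.Adj (q.symm (true, true)) (q.symm (false, false))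
    · by_cases d2 : G.Adj (q.symm (true, false)) (q.symm (false, true))
      · simp [hn, hy, d1, d2, s1.1 d1, s2.1 d2] at hcount
      · exact path (true, false) (false, false) (true, true) (false, true) (by decide)
          (hy _ _ _ (by decide)) d1.symm (hy _ _ _ (by decide)) (hn _ _ _) (hn _ _ _) d2
    · by_cases d2 : G.Adj (q.symm (true, false)) (q.symm (false, true))
      · exact path (true, true) (false, true) (true, false) (false, false) (by decide)
          (hy _ _ _ (by decide)) d2.symm (hy _ _ _ (by decide)) (hn _ _ _) (hn _ _ _) d1
      · simp [hn, hy, d1, d2, s1.not.1 d1, s2.not.1 d2] at hcount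

end SelfComplementary

/-! ### Incidence graphs have unbounded clique-width -/

section LowerBound

open Classical in
/-- There is a set `S` of vertices of `e` containing at least `t` and fewer than `2t` members of
`A`, with a labelling such that vertices of `S` sharing a label have the same final label and
cannot be told apart from outside `S`. -/
def CWExpr.HasBalancedSet {k : ℕ} (e : CWExpr k) (A : Finset e.Vert) (t : ℕ) : Prop :=
  ∃ (S : Set e.Vert) (ℓ : e.Vert → Fin k),
    t ≤ (A.filter (· ∈ S)).card ∧ (A.filter (· ∈ S)).card < 2 * t ∧
    ∀ u ∈ S, ∀ v ∈ S, ℓ u = ℓ v → e.label u = e.label v ∧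
      ∀ w ∉ S, e.graph.Adj u w ↔ e.graph.Adj v w

theorem CWExpr.HasBalancedSet.of_card_lt {k t : ℕ} {e : CWExpr k} {A : Finset e.Vert}
    (hA : t ≤ A.card) (hA' : A.card < 2 * t) : e.HasBalancedSet A t :=
  ⟨Set.univ, e.label, by simpa using hA, by simpa using hA',
    fun _ _ _ _ h => ⟨h, fun _ hw => (hw trivial).elim⟩⟩

theorem CWExpr.HasBalancedSet.of_embedding {k t : ℕ} {e' e : CWExpr k} {B : Finset e'.Vert}
    {A : Finset e.Vert} (h : e'.HasBalancedSet B t) (ι : e'.graph ↪g e.graph)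
    (hlabel : ∀ u, e.label (ι u) = e'.label u) (hB : ∀ u, u ∈ B ↔ ι u ∈ A)
    (hout : ∀ u, ∀ w ∉ Set.range ι, ¬ e.graph.Adj (ι u) w) : e.HasBalancedSet A t := by
  classical
  obtain ⟨S, ℓ, h1, h2, h3⟩ := h
  have hcard : (A.filter (· ∈ ι '' S)).card = (B.filter (· ∈ S)).card := by
    rw [← Finset.card_map ι.toEmbedding]
    congr 1
    ext x
    simp only [Finset.mem_filter, Finset.mem_map, Set.mem_image]
    constructor
    · rintro ⟨hx, u, hu, rfl⟩
      exact ⟨u, ⟨(hB u).2 hx, hu⟩, rfl⟩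
    · rintro ⟨u, ⟨huB, hu⟩, rfl⟩
      exact ⟨(hB u).1 huB, u, hu, rfl⟩
  -- The default `e.label` is never used, since only labels on `ι '' S` matter.
  refine ⟨ι '' S, Function.extend ι ℓ e.label, ?_, ?_, ?_⟩
  · convert h1
  · convert h2
  rintro _ ⟨u, hu, rfl⟩ _ ⟨v, hv, rfl⟩ huv
  rw [ι.injective.extend_apply, ι.injective.extend_apply] at huv
  obtain ⟨hl, hadj⟩ := h3 u hu v hv huv
  refine ⟨by rw [hlabel, hlabel, hl], fun w hw => ?_⟩
  by_cases hr : w ∈ Set.range ι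
  · obtain ⟨w, rfl⟩ := hr
    rw [ι.map_adj_iff, ι.map_adj_iff]
    exact hadj w fun hwS => hw ⟨w, hwS, rfl⟩
  · exact iff_of_false (hout u w hr) (hout v w hr)

/-- Descend to a union side holding at least `t` members of `A` until fewer than `2t` remain, and
take all vertices there with their current labels. Later operations treat equally labelled vertices
alike. -/
theorem CWExpr.hasBalancedSet {k t : ℕ} (ht : 0 < t) (e : CWExpr k) (A : Finset e.Vert)
    (hA : t ≤ A.card) : e.HasBalancedSet A t := by
  induction e with
  | vertex i =>
    have : A.card ≤ 1 := Finset.card_le_one.2 fun a _ b _ => by cases a; cases b; rfl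
    exact .of_card_lt hA (by omega)
  | union e₁ e₂ ih₁ ih₂ =>
    by_cases hsmall : A.card < 2 * t
    · exact .of_card_lt hA hsmall
    have hsum : (Finset.toLeft A).card + (Finset.toRight A).card = A.card :=
      Finset.card_toLeft_add_card_toRight
    obtain h | h : t ≤ (Finset.toLeft A).card ∨ t ≤ (Finset.toRight A).card := by omega
    · refine (ih₁ _ h).of_embedding (e := .union e₁ e₂)
        (SimpleGraph.Embedding.sumInl (G := e₁.graph) (H := e₂.graph)) (fun _ => rfl)
        (fun _ => Finset.mem_toLeft) ?_
      rintro u (w | w) hw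
      · exact (hw ⟨w, rfl⟩).elim
      · change ¬ (e₁.graph.sum e₂.graph).Adj (Sum.inl u) (Sum.inr w)
        simp
    · refine (ih₂ _ h).of_embedding (e := .union e₁ e₂)
        (SimpleGraph.Embedding.sumInr (G := e₁.graph) (H := e₂.graph)) (fun _ => rfl)
        (fun _ => Finset.mem_toRight) ?_
      rintro u (w | w) hw
      · change ¬ (e₁.graph.sum e₂.graph).Adj (Sum.inr u) (Sum.inl w)
        simp
      · exact (hw ⟨w, rfl⟩).elim
  | join i j hij e ih =>
    obtain ⟨S, ℓ, h1, h2, h3⟩ := ih A hA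
    refine ⟨S, ℓ, h1, h2, fun u hu v hv huv => ?_⟩
    obtain ⟨hl, hadj⟩ := h3 u hu v hv huv
    refine ⟨hl, fun w hw => ?_⟩
    have hu' : u ≠ w := by rintro rfl; exact hw hu
    have hv' : v ≠ w := by rintro rfl; exact hw hv
    refine CWExpr.join_adj.trans (Iff.trans ?_ CWExpr.join_adj.symm)
    rw [hadj w hw, hl]
    exact or_congr_right (and_congr_left' (iff_of_true hu' hv'))
  | relabel i j e ih =>
    obtain ⟨S, ℓ, h1, h2, h3⟩ := ih A hA
    refine ⟨S, ℓ, h1, h2, fun u hu v hv huv => ?_⟩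
    obtain ⟨hl, hadj⟩ := h3 u hu v hv huv
    exact ⟨by simp [CWExpr.label, hl], hadj⟩

/-- The bipartite graph of incidences between the elements of `Fin m` and the pairs of them. -/
def pairIncidence (m : ℕ) : SimpleGraph (ULift.{u} (Fin m ⊕ Fin m × Fin m)) where
  Adj x y := match x.down, y.down with
    | .inl a, .inr p => a = p.1 ∨ a = p.2
    | .inr p, .inl a => a = p.1 ∨ a = p.2
    | _, _ => False
  symm := ⟨by rintro ⟨a | p⟩ ⟨b | r⟩ h <;> exact h⟩
  loopless := ⟨by rintro ⟨a | p⟩ h <;> exact h⟩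

def pairIncidenceColoring (m : ℕ) : (pairIncidence.{u} m).Coloring Bool :=
  SimpleGraph.Coloring.mk (fun x => x.down.isLeft) (by
    rintro ⟨a | p⟩ ⟨b | r⟩ h
    · exact h.elim
    · simp
    · simp
    · exact h.elim)

theorem not_constructibleWith_pairIncidence {k m : ℕ} (hm : 3 * k + 2 ≤ m) :
    ¬ ConstructibleWith k (pairIncidence.{u} m) := by
  classical
  rintro (hV | ⟨e, ⟨φ⟩⟩)
  · exact hV.elim ⟨.inl ⟨0, by omega⟩⟩
  let a : Fin m ↪ e.Vert := ⟨fun i => φ.symm ⟨.inl i⟩, fun i j h => by simpa using h⟩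
  let b : Fin m × Fin m → e.Vert := fun p => φ.symm ⟨.inr p⟩
  have hab : ∀ i p, e.graph.Adj (a i) (b p) ↔ i = p.1 ∨ i = p.2 := fun i p =>
    φ.symm.map_adj_iff
  -- With `t = k + 1`, between `k + 1` and `2k + 1` elements lie in `S`, and `m ≥ 3k + 2` leaves at
  -- least `k + 1` outside: pigeonhole applies on both sides.
  obtain ⟨S, ℓ, h1, h2, h3⟩ := e.hasBalancedSet (Nat.succ_pos k) (Finset.univ.map a)
    (by simp; omega)
  rw [Finset.filter_map, Finset.card_map] at h1 h2
  obtain ⟨I, hI⟩ : ∃ I : Finset (Fin m), I = Finset.univ.filter (fun i => a i ∈ S) := ⟨_, rfl⟩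
  have memI : ∀ i, i ∈ I ↔ a i ∈ S := by simp [hI]
  change _ ≤ (Finset.univ.filter (fun i => a i ∈ S)).card at h1
  change (Finset.univ.filter (fun i => a i ∈ S)).card < _ at h2
  rw [← hI] at h1 h2
  obtain ⟨i, hi, j, hj, hij, hℓ⟩ := Finset.exists_ne_map_eq_of_card_lt_of_maps_to
    (s := I) (t := Finset.univ) (f := fun i => ℓ (a i)) (by simp; omega) (by simp)
  -- The pair `(i, x)` tells `a i` from `a j`, so it cannot lie outside `S`.
  have hb : ∀ x ∉ I, b (i, x) ∈ S := by
    intro x hx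
    by_contra hbS
    have := (h3 _ ((memI i).1 hi) _ ((memI j).1 hj) hℓ).2 _ hbS
    rw [hab, hab] at this
    rcases this.1 (Or.inl rfl) with h | h
    · exact hij h.symm
    · exact hx ((show j = x from h) ▸ hj)
  obtain ⟨x, hx, y, hy, hxy, hℓ'⟩ := Finset.exists_ne_map_eq_of_card_lt_of_maps_to
    (s := Iᶜ) (t := Finset.univ) (f := fun x => ℓ (b (i, x)))
    (by rw [Finset.card_compl]; simp; omega) (by simp)
  rw [Finset.mem_compl] at hx hy
  -- The outside vertex `a x` separates the equally labelled pairs `(i, x)` and `(i, y)`.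
  have := (h3 _ (hb x hx) _ (hb y hy) hℓ').2 (a x) (fun h => hx ((memI x).2 h))
  rw [SimpleGraph.adj_comm, hab, SimpleGraph.adj_comm, hab] at this
  rcases this.1 (Or.inr rfl) with h | h
  · exact hx ((show x = i from h) ▸ hi)
  · exact hxy h

end LowerBound

theorem mainTheorem4 (ℋ : Set FinGraph.{u})
    (hne : ∀ H ∈ ℋ, H.IsNonempty) (hsc : ∀ H ∈ ℋ, H.IsSelfComplementary) :
    HasBoundedCliqueWidth (FinGraph.freeClass ℋ) ↔
      FinGraph.PathMem 1 ℋ ∨ FinGraph.PathMem 4 ℋ := by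
  constructor
  · rintro ⟨c, hc⟩
    by_contra hpath
    have hfree : (⟨_, pairIncidence (3 * c + 2)⟩ : FinGraph.{u}) ∈ FinGraph.freeClass ℋ := by
      rintro H hH ⟨f⟩
      have := H.finite
      have : Nonempty H.V := hne H hH
      obtain ⟨φ⟩ := hsc H hH
      rcases SimpleGraph.iso_pathGraph_of_iso_compl_of_coloring φ
        ((pairIncidenceColoring _).comp f.toHom) with h | h
      · exact hpath (Or.inl ⟨H, hH, h⟩)
      · exact hpath (Or.inr ⟨H, hH, h⟩)
    obtain ⟨k, hk, hcon⟩ := exists_constructibleWith_of_cliqueWidth_le (hc _ hfree)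
    exact not_constructibleWith_pairIncidence (by omega) hcon
  · rintro (⟨H, hH, ⟨φ⟩⟩ | ⟨H, hH, ⟨φ⟩⟩)
    · refine ⟨0, fun G hG => cliqueWidth_le_of_constructibleWith (Or.inl ⟨fun v => hG H hH ?_⟩)⟩
      refine ⟨⟨⟨fun _ => v, fun x y _ => φ.injective (Subsingleton.elim _ _)⟩, ?_⟩⟩
      intro x y
      rw [φ.injective (Subsingleton.elim (φ x) (φ y))]
      simp
    · refine ⟨2, fun G hG => ?_⟩
      have := G.finite
      refine cliqueWidth_le_of_constructibleWith
        (SimpleGraph.inducedPathFree_of_not_isIndContained ?_).constructibleWith_two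
      rintro ⟨f⟩
      exact hG H hH ⟨f.comp φ.toEmbedding⟩
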